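/- Let $\mathcal H$ be a separable complex Hilbert space, $U$ a unitary operator on $\mathcal H$, $\psi\in\mathcal H$ with $\|\psi\|=1$, and $\psi(k)=U^k\psi$. Let $\mu_\psi$ be the spectral measure of $U$ and $\psi$, i.e. the Borel probability measure on the unit circle $\partial\mathbb D=\{z\in\mathbb C:|z|=1\}$ with $\langle\psi,f(U)\psi\rangle=\int f\,d\mu_\psi$ for all continuous functions $f$ on $\partial\mathbb D$. Suppose that $\mu_\psi$ is uniformly $\alpha$-Hölder continuous for some $0\le\alpha\le1$, i.e. there is $c>0$ such that $\mu_\psi(I)<c\,|I|^\alpha$ for every nondegenerate arc $I\subseteq\partial\mathbb D$, where $|I|$ is the length of $I$. Then there is a constant $C_\psi>0$ such that for every compact operator $A$ on $\mathcal H$ and every integer $p\ge1$ the following holds. If $\alpha<1$, then for every integer $K\ge1$ $$\frac1K\sum_{k=0}^{K-1}|\langle\psi(k),A\psi(k)\rangle|\le C_\psi^{1/p}\,\|A\|_p\,K^{-\alpha/p};$$ if $\alpha=1$, then for every integer $K\ge2$ $$\frac1K\sum_{k=0}^{K-1}|\langle\psi(k),A\psi(k)\rangle|\le C_\psi^{1/p}\,\|A\|_p\left(\frac{\log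 K}{K}\right)^{1/p}.$$ Both inequalities are strict if $A\ne0$. Here $\|A\|_p=(\operatorname{tr}|A|^p)^{1/p}\in[0,\infty]$ is the Schatten $p$-norm, where $|A|=(A^*A)^{1/2}$; the value $\|A\|_p=\infty$ is allowed, and then the right-hand sides are $+\infty$. -/

import Mathlib

open MeasureTheory
open scoped InnerProductSpace CompactlySupported ENNReal

noncomputable section

/-! ### The spectral measure of a unitary operator -/

/-- The unit circle `∂𝔻` in `ℂ`. -/
abbrev UnitCirc : Type := Metric.sphere (0 : ℂ) 1

section SpectralMeasure

variable {H : Type*} [NormedAddCommGroup H] [InnerProductSpace ℂ H] [CompleteSpace H]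

/-- The inclusion of the spectrum of a unitary operator into the unit circle. -/
def spectrumInclusion (U : unitary (H →L[ℂ] H)) :
    C(spectrum ℂ (U : H →L[ℂ] H), UnitCirc) where
  toFun := Set.inclusion (spectrum.subset_circle_of_unitary U.2)
  continuous_toFun := continuous_inclusion _

/-- The continuous functional calculus `f ↦ f(U)` of a unitary operator `U`, for continuous
functions `f` on the unit circle. -/
def circleCalculus (U : unitary (H →L[ℂ] H)) : C(UnitCirc, ℂ) →⋆ₐ[ℂ] (H →L[ℂ] H) :=
  (cfcHom (R := ℂ) (p := IsStarNormal) (a := (U : H →L[ℂ] H)) inferInstance).comp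
    (ContinuousMap.compStarAlgHom' ℂ ℂ (spectrumInclusion U))

/-- The functional calculus maps the coordinate function `z` to `U`. -/
theorem circleCalculus_id (U : unitary (H →L[ℂ] H)) :
    circleCalculus U ⟨fun z => (z : ℂ), continuous_subtype_val⟩ = (U : H →L[ℂ] H) :=
  cfcHom_id (R := ℂ) (p := IsStarNormal) (a := (U : H →L[ℂ] H)) inferInstance

/-- The functional calculus maps nonnegative functions to positive operators. -/
theorem circleCalculus_inner_nonneg (U : unitary (H →L[ℂ] H)) (ψ : H) (f : C(UnitCirc, ℝ))
    (hf : ∀ z, 0 ≤ f z) :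
    0 ≤ (⟪ψ, circleCalculus U (f.realToRCLike ℂ) ψ⟫_ℂ).re := by
  set g : C(UnitCirc, ℝ) := ⟨fun z => √(f z), by fun_prop⟩ with hg
  have h1 : f.realToRCLike ℂ = star (g.realToRCLike ℂ) * g.realToRCLike ℂ := by
    ext z
    simp [hg, ← Complex.ofReal_mul, Real.mul_self_sqrt (hf z)]
  rw [h1, map_mul, map_star, mul_apply_eq_comp,
    ContinuousLinearMap.star_eq_adjoint, ContinuousLinearMap.adjoint_inner_right]
  exact inner_self_nonneg (𝕜 := ℂ)

/-- The positive linear functional `f ↦ ⟨ψ, f(U)ψ⟩` on real continuous functions on the circle. -/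
def spectralFunctional (U : unitary (H →L[ℂ] H)) (ψ : H) : C_c(UnitCirc, ℝ) →ₚ[ℝ] ℝ :=
  PositiveLinearMap.mk₀
    { toFun := fun f => (⟪ψ, circleCalculus U (f.toContinuousMap.realToRCLike ℂ) ψ⟫_ℂ).re
      map_add' := fun f g => by
        have : (f + g).toContinuousMap.realToRCLike ℂ =
            f.toContinuousMap.realToRCLike ℂ + g.toContinuousMap.realToRCLike ℂ := by
          ext z; simp
        rw [this, map_add, add_apply, inner_add_right, Complex.add_re]
      map_smul' := fun c f => by
        have : (c • f).toContinuousMap.realToRCLike ℂ =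
            (c : ℂ) • f.toContinuousMap.realToRCLike ℂ := by
          ext z; simp
        rw [this, map_smul, smul_apply, inner_smul_right,
          Complex.re_ofReal_mul]
        rfl }
    (fun f hf => circleCalculus_inner_nonneg U ψ f.toContinuousMap hf)

/-- The spectral measure `μ_ψ` of the unitary operator `U` and the vector `ψ`: the Borel measure
on the unit circle that represents the functional `f ↦ ⟨ψ, f(U)ψ⟩`. -/
def spectralMeasure (U : unitary (H →L[ℂ] H)) (ψ : H) : Measure UnitCirc :=
  RealRMK.rieszMeasure (spectralFunctional U ψ)

/-- The defining property of the spectral measure, for real continuous functions. -/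
theorem integral_spectralMeasure (U : unitary (H →L[ℂ] H)) (ψ : H) (f : C(UnitCirc, ℝ)) :
    ((∫ z, f z ∂(spectralMeasure U ψ) : ℝ) : ℂ) =
      ⟪ψ, circleCalculus U (f.realToRCLike ℂ) ψ⟫_ℂ := by
  have h := RealRMK.integral_rieszMeasure (spectralFunctional U ψ)
    (CompactlySupportedContinuousMap.continuousMapEquiv f)
  have h2 : (∫ z, f z ∂(spectralMeasure U ψ) : ℝ) =
      (⟪ψ, circleCalculus U (f.realToRCLike ℂ) ψ⟫_ℂ).re := h
  rw [h2]
  have hs : star (f.realToRCLike ℂ) = f.realToRCLike ℂ := by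
    ext z; simp
  apply Complex.conj_eq_iff_re.mp
  rw [inner_conj_symm]
  nth_rewrite 1 [← hs]
  rw [map_star, ContinuousLinearMap.star_eq_adjoint, ContinuousLinearMap.adjoint_inner_left]

end SpectralMeasure

/-! ### Uniform Hölder continuity -/

/-- The closed arc `{e^{iθ} : a ≤ θ ≤ b}` of the unit circle. For `a ≤ b ≤ a + 2π` its
one-dimensional Lebesgue measure is `b - a`. -/
def circArc (a b : ℝ) : Set UnitCirc :=
  {z | ∃ θ ∈ Set.Icc a b, (z : ℂ) = Complex.exp (θ * Complex.I)}

/-- A measure `μ` on the unit circle is uniformly `α`-Hölder continuous if there is `C > 0` with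
`μ(I) < C |I|^α` for every nondegenerate arc `I`. It suffices to ask this of closed arcs, since
every nondegenerate arc is contained in a closed arc of the same length. -/
def UniformlyHolder (α : ℝ) (μ : Measure UnitCirc) : Prop :=
  ∃ C : ℝ, 0 < C ∧ ∀ a b : ℝ, a < b → b ≤ a + 2 * Real.pi →
    μ (circArc a b) < ENNReal.ofReal (C * (b - a) ^ α)

/-! ### Trace and Schatten norms -/

/-- Parseval's identity, in `[0, ∞]`. -/
theorem ofReal_norm_sq_eq_tsum {H : Type*} [NormedAddCommGroup H] [InnerProductSpace ℂ H]
    {ι : Type*} (b : HilbertBasis ι ℂ H) (x : H) :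
    ENNReal.ofReal (‖x‖ ^ 2) = ∑' i, ENNReal.ofReal (‖⟪b i, x⟫_ℂ‖ ^ 2) := by
  have h := Complex.hasSum_re (b.hasSum_inner_mul_inner x x)
  have e : ∀ i, (⟪x, b i⟫_ℂ * ⟪b i, x⟫_ℂ).re = ‖⟪b i, x⟫_ℂ‖ ^ 2 := fun i => by
    rw [← inner_conj_symm x (b i), mul_comm, Complex.mul_conj, Complex.ofReal_re,
      Complex.normSq_eq_norm_sq]
  simp only [e] at h
  rw [show (⟪x, x⟫_ℂ).re = ‖x‖ ^ 2 from inner_self_eq_norm_sq (𝕜 := ℂ) x] at h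
  rw [← h.tsum_eq, ENNReal.ofReal_tsum_of_nonneg (fun i => sq_nonneg _) h.summable]

section Schatten

variable {H : Type*} [NormedAddCommGroup H] [InnerProductSpace ℂ H] [CompleteSpace H]

/-- The sum `∑ ⟨b_i, T b_i⟩ ∈ [0, ∞]` over an orthonormal basis `b`, for a positive operator. -/
def basisTrace {ι : Type*} (b : HilbertBasis ι ℂ H) (T : H →L[ℂ] H) : ℝ≥0∞ :=
  ∑' i, ENNReal.ofReal (⟪b i, T (b i)⟫_ℂ).re

/-- The trace in `[0, ∞]` of a positive operator, computed in some orthonormal basis;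
by `posTrace_eq` below the choice of the basis does not matter. -/
def posTrace (T : H →L[ℂ] H) : ℝ≥0∞ :=
  basisTrace (exists_hilbertBasis ℂ H).choose_spec.choose T

/-- The trace of a positive operator does not depend on the orthonormal basis. -/
theorem basisTrace_eq {ι κ : Type*} (b : HilbertBasis ι ℂ H) (c : HilbertBasis κ ℂ H)
    {T : H →L[ℂ] H} (hT : 0 ≤ T) : basisTrace b T = basisTrace c T := by
  set S := CFC.sqrt T
  have hS : T = S * S := (CFC.sqrt_mul_sqrt_self T hT).symm
  have hSa : ContinuousLinearMap.adjoint S = S :=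
    (ContinuousLinearMap.star_eq_adjoint S).symm.trans
      (IsSelfAdjoint.of_nonneg (CFC.sqrt_nonneg T))
  have hsymm : ∀ x y : H, ⟪S x, y⟫_ℂ = ⟪x, S y⟫_ℂ := fun x y => by
    rw [← ContinuousLinearMap.adjoint_inner_right, hSa]
  have key : ∀ x : H, (⟪x, T x⟫_ℂ).re = ‖S x‖ ^ 2 := fun x => by
    rw [hS, mul_apply_eq_comp, ← hsymm]
    exact inner_self_eq_norm_sq (𝕜 := ℂ) (S x)
  unfold basisTrace
  simp only [key]
  calc ∑' i, ENNReal.ofReal (‖S (b i)‖ ^ 2)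
      = ∑' i, ∑' j, ENNReal.ofReal (‖⟪c j, S (b i)⟫_ℂ‖ ^ 2) := by
        simp only [ofReal_norm_sq_eq_tsum c]
    _ = ∑' j, ∑' i, ENNReal.ofReal (‖⟪c j, S (b i)⟫_ℂ‖ ^ 2) := ENNReal.tsum_comm
    _ = ∑' j, ENNReal.ofReal (‖S (c j)‖ ^ 2) := by
        refine tsum_congr fun j => ?_
        rw [ofReal_norm_sq_eq_tsum b]
        refine tsum_congr fun i => ?_
        rw [← hsymm, ← inner_conj_symm, RCLike.norm_conj]

theorem posTrace_eq {ι : Type*} (b : HilbertBasis ι ℂ H) {T : H →L[ℂ] H} (hT : 0 ≤ T) :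
    posTrace T = basisTrace b T :=
  basisTrace_eq _ b hT

/-- The Schatten norm `‖A‖_p = (tr |A|^p)^{1/p} ∈ [0, ∞]`, where `|A| = (A^* A)^{1/2}`. -/
def schattenNorm (p : ℕ) (A : H →L[ℂ] H) : ℝ≥0∞ :=
  posTrace (CFC.abs A ^ p) ^ (1 / (p : ℝ))

end Schatten

/-! ### Time averages -/

/-- The average `(1/K) ∑_{k=0}^{K-1} |⟨ψ(k), A ψ(k)⟩|`, where `ψ(k) = U^k ψ`. -/
def timeAverage {H : Type*} [NormedAddCommGroup H] [InnerProductSpace ℂ H] [CompleteSpace H]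
    (U : unitary (H →L[ℂ] H)) (ψ : H) (A : H →L[ℂ] H) (K : ℕ) : ℝ :=
  1 / (K : ℝ) * ∑ k ∈ Finset.range K,
    ‖⟪((U : H →L[ℂ] H) ^ k) ψ, A (((U : H →L[ℂ] H) ^ k) ψ)⟫_ℂ‖

end

/-!
The time average is controlled by the numbers `(1/K) ∑_{k<K} |⟨φ, U^k ψ⟩|²` for unit vectors `φ`,
and these are bounded by `B K^{-α}` uniformly in `φ`.

*Decay of `(1/K) ∑_{k<K} |⟨φ, U^k ψ⟩|²`.* By duality (`sum_norm_inner_sq_le_of_dual`) it is enough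
to bound `‖∑_{k<K} c_k U^k ψ‖²`, which equals `∫ |P|² dμ_ψ` for `P(z) = ∑_{k<K} c_k z^k`
(`norm_sq_sum_smul_pow_eq_lintegral`). This integral is estimated as in the large sieve: the circle
is cut into `K` arcs of length `2π/K`, each of measure at most a constant times `K^{-α}`, and on
each arc the supremum of `|P|²` is bounded by integrals of `|P|²` and `|P'|²` over that arc
(`norm_sq_le_integral_add_deriv`). Summing over the arcs and applying Parseval's identity to `P` and
`P'` gives `∫ |P|² dμ_ψ ≤ B K^{1-α} ∑ |c_k|²` (`UniformlyHolder.exists_lintegral_le`). No logarithm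
is lost for `α = 1`.

*Passage to compact operators.* Let `b_i` be an orthonormal eigenbasis of `A^*A`, with singular
values `s_i = ‖A b_i‖`, and let `u_i = A b_i / s_i`. Then
`|⟨x, A x⟩| ≤ ∑ s_i (|⟨b_i, x⟩|² + |⟨u_i, x⟩|²) / 2`, so the time average is at most `∑ a_i s_i`,
where `a_i ≤ B K^{-α}` by the first part and `∑ a_i ≤ 1` by Bessel's inequality. Jensen's inequality
`∑ a_i s_i ≤ (∑ a_i s_i^p)^{1/p}` gives the bound `(B K^{-α})^{1/p} ‖A‖_p`
(`ofReal_timeAverage_le`). The constant `2B` makes it strict for `A ≠ 0`.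
-/

/-! ### Trigonometric polynomials -/

/-- The trigonometric polynomial `∑_{k < K} c_k e^{ikθ}`. -/
noncomputable def trigPoly (K : ℕ) (c : ℕ → ℂ) (θ : ℝ) : ℂ :=
  ∑ k ∈ Finset.range K, c k * Complex.exp (θ * Complex.I) ^ k

theorem hasDerivAt_trigPoly (K : ℕ) (c : ℕ → ℂ) (θ : ℝ) :
    HasDerivAt (trigPoly K c) (trigPoly K (fun k => k * Complex.I * c k) θ) θ := by
  unfold trigPoly
  refine HasDerivAt.fun_sum fun k _ => ?_
  simp only [← Complex.exp_nat_mul]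
  have h : HasDerivAt (fun θ : ℝ => (k : ℂ) * (θ * Complex.I)) (k * (1 * Complex.I)) θ :=
    ((Complex.ofRealCLM.hasDerivAt (x := θ)).mul_const Complex.I).const_mul (k : ℂ)
  exact (h.cexp.const_mul (c k)).congr_deriv (by ring)

@[fun_prop]
theorem continuous_trigPoly (K : ℕ) (c : ℕ → ℂ) : Continuous (trigPoly K c) := by
  unfold trigPoly
  fun_prop

theorem integral_exp_pow_mul_conj_exp_pow (k l : ℕ) :
    ∫ θ in (0 : ℝ)..2 * Real.pi, Complex.exp (θ * Complex.I) ^ k *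
      (starRingEnd ℂ) (Complex.exp (θ * Complex.I) ^ l) = if k = l then 2 * Real.pi else 0 := by
  have h : ∀ θ : ℝ, Complex.exp (θ * Complex.I) ^ k *
      (starRingEnd ℂ) (Complex.exp (θ * Complex.I) ^ l) =
        Complex.exp (((k : ℂ) - l) * Complex.I * θ) := fun θ => by
    rw [map_pow, ← Complex.exp_conj, ← Complex.exp_nat_mul, ← Complex.exp_nat_mul,
      ← Complex.exp_add]
    congr 1
    simp
    ring
  simp only [h]
  split_ifs with hkl
  · subst hkl; simp
  · have hne : ((k : ℂ) - l) * Complex.I ≠ 0 :=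
      mul_ne_zero (sub_ne_zero.mpr (by exact_mod_cast hkl)) Complex.I_ne_zero
    rw [integral_exp_mul_complex hne]
    have : Complex.exp (((k : ℂ) - l) * Complex.I * (2 * Real.pi : ℝ)) = 1 := by
      rw [Complex.exp_eq_one_iff]
      exact ⟨(k : ℤ) - l, by push_cast; ring⟩
    rw [this]
    simp

/-- Parseval's identity for trigonometric polynomials. -/
theorem integral_norm_sq_trigPoly (K : ℕ) (c : ℕ → ℂ) :
    ∫ θ in (0 : ℝ)..2 * Real.pi, ‖trigPoly K c θ‖ ^ 2 =
      2 * Real.pi * ∑ k ∈ Finset.range K, ‖c k‖ ^ 2 := by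
  have h : ∀ θ : ℝ, ((‖trigPoly K c θ‖ ^ 2 : ℝ) : ℂ) =
      ∑ k ∈ Finset.range K, ∑ l ∈ Finset.range K, c k * (starRingEnd ℂ) (c l) *
        (Complex.exp (θ * Complex.I) ^ k *
          (starRingEnd ℂ) (Complex.exp (θ * Complex.I) ^ l)) := fun θ => by
    rw [← Complex.normSq_eq_norm_sq, ← Complex.mul_conj, trigPoly, map_sum, Finset.sum_mul_sum]
    refine Finset.sum_congr rfl fun k _ => Finset.sum_congr rfl fun l _ => ?_
    rw [map_mul]
    ring
  apply Complex.ofReal_injective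
  rw [← intervalIntegral.integral_ofReal]
  simp only [h]
  rw [intervalIntegral.integral_finsetSum
    fun k _ => Continuous.intervalIntegrable (by fun_prop) _ _]
  push_cast
  rw [Finset.mul_sum]
  refine Finset.sum_congr rfl fun k hk => ?_
  rw [intervalIntegral.integral_finsetSum
    fun l _ => Continuous.intervalIntegrable (by fun_prop) _ _]
  simp only [intervalIntegral.integral_const_mul, integral_exp_pow_mul_conj_exp_pow]
  rw [Finset.sum_eq_single_of_mem k hk fun l _ hl => by simp [hl.symm]]
  rw [Complex.mul_conj, Complex.normSq_eq_norm_sq]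
  simp [mul_comm]

/-- Gallagher's inequality: the value of `‖P‖²` at a point of an interval is controlled by integrals
of `‖P‖²` and `‖P'‖²` over that interval. -/
theorem norm_sq_le_integral_add_deriv {P P' : ℝ → ℂ} (hP : ∀ t, HasDerivAt P (P' t) t)
    (hP' : Continuous P') {a b L θ : ℝ} (hab : a < b) (hL : 0 < L) (hθ : θ ∈ Set.Icc a b) :
    ‖P θ‖ ^ 2 ≤ ∫ t in a..b, (((b - a)⁻¹ + L) * ‖P t‖ ^ 2 + L⁻¹ * ‖P' t‖ ^ 2) := by
  have hPc : Continuous P := continuous_iff_continuousAt.mpr fun t => (hP t).continuousAt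
  set G : ℝ → ℝ := fun t => L * ‖P t‖ ^ 2 + L⁻¹ * ‖P' t‖ ^ 2 with hG
  have hGc : Continuous G := by fun_prop
  have hG0 : ∀ t, 0 ≤ G t := fun t => by positivity
  have hderiv : ∀ t, |2 * inner ℝ (P t) (P' t)| ≤ G t := fun t => by
    have h1 := abs_real_inner_le_norm (P t) (P' t)
    -- the arithmetic-geometric mean inequality with weight `L`
    have h2 : 2 * (‖P t‖ * ‖P' t‖) ≤ G t := by
      have h3 : G t - 2 * (‖P t‖ * ‖P' t‖) = L⁻¹ * (L * ‖P t‖ - ‖P' t‖) ^ 2 := by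
        simp only [hG]; field_simp; ring
      have h4 : 0 ≤ L⁻¹ * (L * ‖P t‖ - ‖P' t‖) ^ 2 := by positivity
      linarith
    rw [abs_mul, abs_two]
    linarith
  have key : ∀ t ∈ Set.Icc a b, ‖P θ‖ ^ 2 ≤ ‖P t‖ ^ 2 + ∫ s in a..b, G s := fun t ht => by
    have hftc : ∫ s in t..θ, 2 * inner ℝ (P s) (P' s) = ‖P θ‖ ^ 2 - ‖P t‖ ^ 2 :=
      intervalIntegral.integral_eq_sub_of_hasDerivAt (fun s _ => (hP s).norm_sq)
        (Continuous.intervalIntegrable (by fun_prop) _ _)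
    have h1 : ‖P θ‖ ^ 2 - ‖P t‖ ^ 2 ≤ |∫ s in t..θ, G s| := by
      rw [← hftc]
      refine (le_abs_self _).trans ?_
      have := intervalIntegral.norm_integral_le_abs_of_norm_le
        (f := fun s => 2 * inner ℝ (P s) (P' s)) (g := G) (a := t) (b := θ) (μ := volume)
        (Filter.Eventually.of_forall fun s => hderiv s) (hGc.intervalIntegrable _ _)
      exact this
    have h2 : |∫ s in t..θ, G s| ≤ |∫ s in a..b, G s| :=
      intervalIntegral.abs_integral_mono_interval
        (Set.uIoc_subset_uIoc_of_uIcc_subset_uIcc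
          (Set.uIcc_subset_uIcc (by rwa [Set.uIcc_of_le hab.le]) (by rwa [Set.uIcc_of_le hab.le])))
        (Filter.Eventually.of_forall hG0) (hGc.intervalIntegrable _ _)
    rw [abs_of_nonneg (intervalIntegral.integral_nonneg hab.le fun s _ => hG0 s)] at h2
    linarith
  have hint : ∫ _t in a..b, ‖P θ‖ ^ 2 ≤ ∫ t in a..b, (‖P t‖ ^ 2 + ∫ s in a..b, G s) :=
    intervalIntegral.integral_mono_on hab.le (Continuous.intervalIntegrable (by fun_prop) _ _)
      (Continuous.intervalIntegrable (by fun_prop) _ _) key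
  have hba : 0 < b - a := sub_pos.mpr hab
  rw [intervalIntegral.integral_add (Continuous.intervalIntegrable (by fun_prop) _ _)
    (Continuous.intervalIntegrable (by fun_prop) _ _)] at hint
  simp only [intervalIntegral.integral_const, smul_eq_mul] at hint
  have hsplit : ∫ t in a..b, (((b - a)⁻¹ + L) * ‖P t‖ ^ 2 + L⁻¹ * ‖P' t‖ ^ 2) =
      (b - a)⁻¹ * (∫ t in a..b, ‖P t‖ ^ 2) + ∫ t in a..b, G t := by
    rw [← intervalIntegral.integral_const_mul, ← intervalIntegral.integral_add
      (Continuous.intervalIntegrable (by fun_prop) _ _) (hGc.intervalIntegrable _ _)]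
    refine intervalIntegral.integral_congr fun t _ => ?_
    simp only [hG]; ring
  rw [hsplit]
  refine le_of_mul_le_mul_left (hint.trans_eq ?_) hba
  field_simp

/-! ### The large sieve inequality on the circle -/

theorem isClosed_circArc (a b : ℝ) : IsClosed (circArc a b) := by
  have h : IsCompact ((fun θ : ℝ => Complex.exp (θ * Complex.I)) '' Set.Icc a b) :=
    isCompact_Icc.image (by fun_prop)
  convert h.isClosed.preimage (continuous_subtype_val (p := fun z => z ∈ Metric.sphere (0 : ℂ) 1))
  ext z
  simp [circArc, eq_comm]

/-- The `K` arcs of length `2π/K` that start at the `K`-th roots of unity cover the circle. -/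
theorem exists_mem_circArc {K : ℕ} (hK : 1 ≤ K) (z : UnitCirc) :
    ∃ j ∈ Finset.range K, z ∈ circArc (j * (2 * Real.pi / K)) ((j + 1 : ℕ) * (2 * Real.pi / K)) := by
  have hK0 : (0 : ℝ) < K := by exact_mod_cast hK
  have hd : 0 < 2 * Real.pi / K := by positivity
  obtain ⟨θ, hθ, hz⟩ : ∃ θ ∈ Set.Ico 0 (2 * Real.pi), (z : ℂ) = Complex.exp (θ * Complex.I) := by
    have h1 : ‖(z : ℂ)‖ = 1 := by simp
    refine ⟨toIcoMod Real.two_pi_pos 0 (z : ℂ).arg, by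
      simpa using toIcoMod_mem_Ico Real.two_pi_pos 0 (z : ℂ).arg, ?_⟩
    rw [toIcoMod]
    have h2 := Complex.norm_mul_exp_arg_mul_I (z : ℂ)
    rw [h1, Complex.ofReal_one, one_mul] at h2
    rw [← h2, Complex.exp_eq_exp_iff_exists_int]
    exact ⟨toIcoDiv Real.two_pi_pos 0 (Complex.arg (Complex.exp ((z : ℂ).arg * Complex.I))), by
      rw [h2]; push_cast; simp; ring⟩
  have h0 : 0 ≤ θ / (2 * Real.pi / K) := div_nonneg hθ.1 hd.le
  refine ⟨⌊θ / (2 * Real.pi / K)⌋₊, ?_, θ, ⟨?_, ?_⟩, hz⟩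
  · rw [Finset.mem_range, Nat.floor_lt h0, div_lt_iff₀ hd]
    exact hθ.2.trans_eq (by field_simp)
  · exact (le_div_iff₀ hd).mp (Nat.floor_le h0)
  · rw [← div_le_iff₀ hd]
    push_cast
    exact (Nat.lt_floor_add_one _).le

/-- The large sieve inequality for a uniformly Hölder continuous measure: the `L²(μ)` norm of a
trigonometric polynomial with `K` coefficients is bounded by `K^{1-α}` times the `ℓ²` norm of the
coefficients. -/
theorem UniformlyHolder.exists_lintegral_le {α : ℝ} {μ : Measure UnitCirc}
    (hμ : UniformlyHolder α μ) :
    ∃ B : ℝ, 0 < B ∧ ∀ K : ℕ, 1 ≤ K → ∀ c : ℕ → ℂ,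
      ∫⁻ z : UnitCirc, ENNReal.ofReal (‖∑ k ∈ Finset.range K, c k * (z : ℂ) ^ k‖ ^ 2) ∂μ ≤
        ENNReal.ofReal (B * (K : ℝ) ^ (1 - α) * ∑ k ∈ Finset.range K, ‖c k‖ ^ 2) := by
  obtain ⟨C, hC, hμ⟩ := hμ
  refine ⟨C * (2 * Real.pi) ^ α * (1 + 4 * Real.pi), by positivity, fun K hK c => ?_⟩
  have hK0 : (0 : ℝ) < K := by exact_mod_cast hK
  have hK1 : (1 : ℝ) ≤ K := by exact_mod_cast hK
  set d : ℝ := 2 * Real.pi / K with hd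
  have hd0 : 0 < d := by positivity
  set c' : ℕ → ℂ := fun k => k * Complex.I * c k
  set W : ℝ → ℝ := fun t => (d⁻¹ + K) * ‖trigPoly K c t‖ ^ 2 + (K : ℝ)⁻¹ * ‖trigPoly K c' t‖ ^ 2
    with hW
  have hWc : Continuous W := by fun_prop
  set s : ℕ → ℝ := fun j => ∫ t in (j * d)..((j + 1 : ℕ) * d), W t with hs
  have hlen : ∀ j : ℕ, ((j + 1 : ℕ) : ℝ) * d - j * d = d := fun j => by push_cast; ring
  have hlt : ∀ j : ℕ, (j : ℝ) * d < ((j + 1 : ℕ) : ℝ) * d := fun j => by linarith [hlen j]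
  have hs0 : ∀ j, 0 ≤ s j := fun j =>
    intervalIntegral.integral_nonneg (hlt j).le fun t _ => by positivity
  have hsup : ∀ j : ℕ, ∀ z ∈ circArc (j * d) ((j + 1 : ℕ) * d),
      ‖∑ k ∈ Finset.range K, c k * (z : ℂ) ^ k‖ ^ 2 ≤ s j := by
    rintro j z ⟨θ, hθ, hz⟩
    have h := norm_sq_le_integral_add_deriv (fun t => hasDerivAt_trigPoly K c t)
      (continuous_trigPoly K _) (hlt j) hK0 hθ
    rw [hlen] at h
    rw [hz]
    exact h
  have hsum : ∑ j ∈ Finset.range K, s j ≤ (1 + 4 * Real.pi) * K * ∑ k ∈ Finset.range K, ‖c k‖ ^ 2 := by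
    have h1 : ∑ j ∈ Finset.range K, s j = ∫ t in (0 : ℝ)..2 * Real.pi, W t := by
      rw [intervalIntegral.sum_integral_adjacent_intervals (a := fun j : ℕ => (j : ℝ) * d)
        fun j _ => hWc.intervalIntegrable _ _]
      congr 1
      · simp
      · rw [hd]; field_simp
    have hc' : ∑ k ∈ Finset.range K, ‖c' k‖ ^ 2 ≤ K ^ 2 * ∑ k ∈ Finset.range K, ‖c k‖ ^ 2 := by
      rw [Finset.mul_sum]
      refine Finset.sum_le_sum fun k hk => ?_
      have hk' : (k : ℝ) ≤ K := by exact_mod_cast (Finset.mem_range.mp hk).le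
      simp only [c', norm_mul, Complex.norm_I, Complex.norm_natCast, mul_one, mul_pow]
      gcongr
    rw [h1, intervalIntegral.integral_add (Continuous.intervalIntegrable (by fun_prop) _ _)
      (Continuous.intervalIntegrable (by fun_prop) _ _), intervalIntegral.integral_const_mul,
      intervalIntegral.integral_const_mul, integral_norm_sq_trigPoly, integral_norm_sq_trigPoly]
    calc _ ≤ (d⁻¹ + K) * (2 * Real.pi * ∑ k ∈ Finset.range K, ‖c k‖ ^ 2) +
          (K : ℝ)⁻¹ * (2 * Real.pi * (K ^ 2 * ∑ k ∈ Finset.range K, ‖c k‖ ^ 2)) := by gcongr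
      _ = _ := by rw [hd]; field_simp; ring
  calc ∫⁻ z : UnitCirc, ENNReal.ofReal (‖∑ k ∈ Finset.range K, c k * (z : ℂ) ^ k‖ ^ 2) ∂μ
      ≤ ∫⁻ z : UnitCirc, ∑ j ∈ Finset.range K, (circArc (j * d) ((j + 1 : ℕ) * d)).indicator
          (fun _ => ENNReal.ofReal (s j)) z ∂μ := by
        refine lintegral_mono fun z => ?_
        obtain ⟨j, hj, hz⟩ := exists_mem_circArc hK z
        refine le_trans ?_ (Finset.single_le_sum (f := fun j : ℕ =>
          (circArc (j * d) ((j + 1 : ℕ) * d)).indicator (fun _ => ENNReal.ofReal (s j)) z)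
          (fun _ _ => zero_le) hj)
        simp only [d, Set.indicator_of_mem hz]
        exact ENNReal.ofReal_le_ofReal (hsup j z hz)
    _ = ∑ j ∈ Finset.range K, ENNReal.ofReal (s j) * μ (circArc (j * d) ((j + 1 : ℕ) * d)) := by
        rw [lintegral_finsetSum _ fun j _ =>
          measurable_const.indicator (isClosed_circArc _ _).measurableSet]
        refine Finset.sum_congr rfl fun j _ => ?_
        rw [lintegral_indicator_const (isClosed_circArc _ _).measurableSet]
    _ ≤ ∑ j ∈ Finset.range K, ENNReal.ofReal (s j) * ENNReal.ofReal (C * d ^ α) := by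
        refine Finset.sum_le_sum fun j _ => ?_
        have hd2 : d ≤ 2 * Real.pi := div_le_self Real.two_pi_pos.le hK1
        have := (hμ (j * d) ((j + 1 : ℕ) * d) (hlt j) (by linarith [hlen j])).le
        rw [hlen] at this
        gcongr
    _ = ENNReal.ofReal ((∑ j ∈ Finset.range K, s j) * (C * d ^ α)) := by
        rw [← Finset.sum_mul, ENNReal.ofReal_mul (Finset.sum_nonneg fun j _ => hs0 j),
          ENNReal.ofReal_sum_of_nonneg fun j _ => hs0 j]
    _ ≤ _ := by
        refine ENNReal.ofReal_le_ofReal ?_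
        calc _ ≤ ((1 + 4 * Real.pi) * K * ∑ k ∈ Finset.range K, ‖c k‖ ^ 2) * (C * d ^ α) := by
              gcongr
          _ = _ := by
              rw [hd, Real.div_rpow Real.two_pi_pos.le hK0.le, Real.rpow_sub hK0, Real.rpow_one]
              ring

/-! ### Singular values of compact operators -/

/-- Expanding `x` in an orthonormal basis bounds the quadratic form of `A`. For a basis of right
singular vectors of `A`, the vectors `A (b i)` on the right-hand side are orthogonal. -/
theorem ofReal_norm_inner_le_tsum {H : Type*} [NormedAddCommGroup H] [InnerProductSpace ℂ H]
    {ι : Type*} (b : HilbertBasis ι ℂ H) (A : H →L[ℂ] H) (x : H) :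
    ENNReal.ofReal ‖⟪x, A x⟫_ℂ‖ ≤ ∑' i, ENNReal.ofReal (‖⟪b i, x⟫_ℂ‖ * ‖⟪A (b i), x⟫_ℂ‖) := by
  have h1 : HasSum (fun i => ⟪b i, x⟫_ℂ * ⟪x, A (b i)⟫_ℂ) ⟪x, A x⟫_ℂ := by
    have h := (b.hasSum_repr x).mapL (innerSL ℂ x ∘L A)
    simpa [b.repr_apply_apply, inner_smul_right] using h
  rw [← h1.tsum_eq, ofReal_norm]
  refine (enorm_tsum_le_tsum_enorm).trans_eq (tsum_congr fun i => ?_)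
  rw [← ofReal_norm, norm_mul, norm_inner_symm x]

section SingularValues

universe u

variable {H : Type u} [NormedAddCommGroup H] [InnerProductSpace ℂ H] [CompleteSpace H]

/-- A compact symmetric operator has an orthonormal basis of eigenvectors. -/
theorem IsCompactOperator.exists_hilbertBasis_eigenvectors {T : H →L[ℂ] H}
    (hT : IsCompactOperator T) (hs : (T : H →ₗ[ℂ] H).IsSymmetric) :
    ∃ (ι : Type u) (b : HilbertBasis ι ℂ H) (ev : ι → ℂ), ∀ i, T (b i) = ev i • b i := by
  have : ∀ μ : ℂ, CompleteSpace (Module.End.eigenspace (T : H →ₗ[ℂ] H) μ) := fun μ => by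
    have hc : IsClosed (Module.End.eigenspace (T : H →ₗ[ℂ] H) μ : Set H) := by
      have h : (Module.End.eigenspace (T : H →ₗ[ℂ] H) μ : Set H) = {x | T x = μ • x} := by
        ext x
        simp
      rw [h]
      exact isClosed_eq (by fun_prop) (by fun_prop)
    exact hc.completeSpace_coe
  choose w b hb using fun μ : ℂ =>
    exists_hilbertBasis ℂ (Module.End.eigenspace (T : H →ₗ[ℂ] H) μ)
  have horth := hs.orthogonalFamily_eigenspaces.orthonormal_sigma_orthonormal
    fun μ => (b μ).orthonormal
  have hbot : (Submodule.span ℂ (Set.range fun a : Σ μ, w μ =>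
      (Module.End.eigenspace (T : H →ₗ[ℂ] H) a.1).subtypeₗᵢ (b a.1 a.2)))ᗮ = ⊥ := by
    rw [eq_bot_iff, ← ContinuousLinearMap.orthogonalComplement_iSup_eigenspaces_eq_bot hT hs]
    intro x hx
    rw [← Submodule.iInf_orthogonal, Submodule.mem_iInf]
    intro μ
    rw [← Submodule.orthogonalProjectionOnto_eq_zero_iff]
    apply (b μ).repr.injective
    ext i
    rw [(b μ).repr_apply_apply, map_zero, Submodule.inner_orthogonalProjectionOnto_eq_of_mem_left]
    exact (Submodule.mem_orthogonal _ _).mp hx _ (Submodule.subset_span ⟨⟨μ, i⟩, rfl⟩)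
  refine ⟨Σ μ, w μ, HilbertBasis.mkOfOrthogonalEqBot horth hbot, fun a => a.1, fun a => ?_⟩
  rw [HilbertBasis.coe_mkOfOrthogonalEqBot]
  exact Module.End.mem_eigenspace_iff.mp (b a.1 a.2).2

/-- If `A^*A b = ‖A b‖² b`, then `b` is an eigenvector of `|A|`. -/
theorem CFC.abs_apply_of_eigenvector {A : H →L[ℂ] H} {b : H}
    (hb : ContinuousLinearMap.adjoint A (A b) = ((‖A b‖ ^ 2 : ℝ) : ℂ) • b) :
    CFC.abs A b = ((‖A b‖ : ℝ) : ℂ) • b := by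
  set S := CFC.abs A with hS
  set e : ℝ := ‖A b‖ with he
  have hS0 : 0 ≤ S := CFC.abs_nonneg A
  have hpos := (ContinuousLinearMap.nonneg_iff_isPositive S).mp hS0
  have hSS : S (S b) = ((e ^ 2 : ℝ) : ℂ) • b := by
    have h := congrArg (fun T : H →L[ℂ] H => T b) (CFC.abs_mul_abs A)
    simpa [ContinuousLinearMap.star_eq_adjoint, hb] using h
  set v := S b - (e : ℂ) • b with hv
  -- `(|A| + e) v = (|A|² - e²) b = 0`
  have hSv : S v = -((e : ℂ) • v) := by
    rw [hv, map_sub, map_smul, hSS]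
    simp only [smul_sub, smul_smul]
    push_cast
    rw [pow_two]
    abel
  have h1 : 0 ≤ (⟪v, S v⟫_ℂ).re := hpos.re_inner_nonneg_right v
  rw [hSv, inner_neg_right, inner_smul_right, Complex.neg_re, Complex.re_ofReal_mul,
    show (⟪v, v⟫_ℂ).re = ‖v‖ ^ 2 from inner_self_eq_norm_sq (𝕜 := ℂ) v] at h1
  rcases (norm_nonneg (A b)).eq_or_lt with h0 | h0
  · -- here `e = 0`, so `‖|A| b‖² = ⟨b, |A|² b⟩ = 0`
    have he0 : e = 0 := h0.symm
    have h2 : ⟪S b, S b⟫_ℂ = 0 := by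
      have h3 := hpos.isSymmetric (S b) b
      simp only [ContinuousLinearMap.coe_coe] at h3
      rw [← h3, hSS, he0]
      simp
    rw [he0, inner_self_eq_zero.mp h2]
    simp
  · have hv0 : ‖v‖ ^ 2 = 0 := by
      have : 0 < e := h0
      nlinarith [sq_nonneg ‖v‖, mul_nonneg this.le (sq_nonneg ‖v‖)]
    have : v = 0 := by simpa using hv0
    exact sub_eq_zero.mp this

/-- The singular value decomposition of a compact operator, in terms of the right singular
vectors `b i`: the singular values are `‖A b_i‖` and the left singular vectors are `A b_i`, up to
normalization. -/
theorem IsCompactOperator.exists_singularBasis {A : H →L[ℂ] H} (hA : IsCompactOperator A) :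
    ∃ (ι : Type u) (b : HilbertBasis ι ℂ H),
      (∀ i, CFC.abs A (b i) = ((‖A (b i)‖ : ℝ) : ℂ) • b i) ∧
      ∀ i j, i ≠ j → ⟪A (b i), A (b j)⟫_ℂ = 0 := by
  have hc : IsCompactOperator (ContinuousLinearMap.adjoint A ∘ A) := hA.clm_comp _
  have hs : ((ContinuousLinearMap.adjoint A ∘L A : H →L[ℂ] H) : H →ₗ[ℂ] H).IsSymmetric :=
    fun x y => by
      simp [ContinuousLinearMap.adjoint_inner_left, ContinuousLinearMap.adjoint_inner_right]
  obtain ⟨ι, b, ev, hb⟩ := IsCompactOperator.exists_hilbertBasis_eigenvectors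
    (T := ContinuousLinearMap.adjoint A ∘L A) hc hs
  have hb' : ∀ i, ContinuousLinearMap.adjoint A (A (b i)) = ev i • b i := hb
  have hinner : ∀ i j, ⟪A (b i), A (b j)⟫_ℂ = ev j * ⟪b i, b j⟫_ℂ := fun i j => by
    rw [← ContinuousLinearMap.adjoint_inner_right, hb', inner_smul_right]
  refine ⟨ι, b, fun i => CFC.abs_apply_of_eigenvector ?_, fun i j hij => ?_⟩
  · rw [hb']
    congr 1
    have h := hinner i i
    rw [inner_self_eq_norm_sq_to_K, inner_self_eq_norm_sq_to_K, b.orthonormal.1 i] at h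
    simpa using h.symm
  · rw [hinner, b.orthonormal.2 hij, mul_zero]

theorem schattenNorm_eq_tsum {A : H →L[ℂ] H} {ι : Type*} (b : HilbertBasis ι ℂ H)
    (hb : ∀ i, CFC.abs A (b i) = ((‖A (b i)‖ : ℝ) : ℂ) • b i) (p : ℕ) :
    schattenNorm p A = (∑' i, ENNReal.ofReal ‖A (b i)‖ ^ p) ^ (1 / (p : ℝ)) := by
  have hpow : ∀ i, (CFC.abs A ^ p) (b i) = ((‖A (b i)‖ ^ p : ℝ) : ℂ) • b i := fun i => by
    induction p with
    | zero => simp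
    | succ n ih =>
      rw [pow_succ, mul_apply_eq_comp, hb, map_smul, ih, smul_smul]
      push_cast
      rw [pow_succ, mul_comm]
  rw [schattenNorm, posTrace_eq b (CStarAlgebra.pow_nonneg (CFC.abs_nonneg A) p), basisTrace]
  congr 2
  ext i
  rw [hpow, inner_smul_right, inner_self_eq_norm_sq_to_K, b.orthonormal.1 i,
    ← ENNReal.ofReal_pow (norm_nonneg _), RCLike.ofReal_one, one_pow, mul_one,
    Complex.ofReal_re]

end SingularValues

/-! ### Averages of transition probabilities -/

section Dynamics

universe u

variable {H : Type u} [NormedAddCommGroup H] [InnerProductSpace ℂ H] [CompleteSpace H]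

/-- The map `P(U)ψ ↦ P` on polynomials is isometric into `L²(μ_ψ)`. -/
theorem norm_sq_sum_smul_pow_eq_lintegral (U : unitary (H →L[ℂ] H)) (ψ : H) (K : ℕ) (c : ℕ → ℂ) :
    ENNReal.ofReal (‖∑ k ∈ Finset.range K, c k • ((U : H →L[ℂ] H) ^ k) ψ‖ ^ 2) =
      ∫⁻ z : UnitCirc, ENNReal.ofReal (‖∑ k ∈ Finset.range K, c k * (z : ℂ) ^ k‖ ^ 2)
        ∂(spectralMeasure U ψ) := by
  set Z : C(UnitCirc, ℂ) := ⟨fun z => (z : ℂ), continuous_subtype_val⟩ with hZ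
  set P : C(UnitCirc, ℂ) := ∑ k ∈ Finset.range K, c k • Z ^ k with hP
  have hPz : ∀ z, P z = ∑ k ∈ Finset.range K, c k * (z : ℂ) ^ k := fun z => by
    simp [hP, hZ, ContinuousMap.sum_apply]
  set f : C(UnitCirc, ℝ) := ⟨fun z => ‖P z‖ ^ 2, by fun_prop⟩ with hf
  have hfP : f.realToRCLike ℂ = star P * P := by
    ext z
    simp [hf, ← Complex.normSq_eq_norm_sq, Complex.normSq_eq_conj_mul_self]
  have hPU : circleCalculus U P ψ = ∑ k ∈ Finset.range K, c k • ((U : H →L[ℂ] H) ^ k) ψ := by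
    rw [hP, map_sum, sum_apply]
    refine Finset.sum_congr rfl fun k _ => ?_
    rw [map_smul, map_pow, circleCalculus_id, smul_apply]
  have hint : ∫ z, f z ∂(spectralMeasure U ψ) =
      ‖∑ k ∈ Finset.range K, c k • ((U : H →L[ℂ] H) ^ k) ψ‖ ^ 2 := by
    apply Complex.ofReal_injective
    rw [integral_spectralMeasure, hfP, map_mul, map_star, mul_apply_eq_comp,
      ContinuousLinearMap.star_eq_adjoint, ContinuousLinearMap.adjoint_inner_right, hPU,
      inner_self_eq_norm_sq_to_K]
    simp
  have : IsFiniteMeasureOnCompacts (spectralMeasure U ψ) := by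
    unfold spectralMeasure
    infer_instance
  have hfi : Integrable f (spectralMeasure U ψ) :=
    f.continuous.integrable_of_hasCompactSupport (HasCompactSupport.of_compactSpace _)
  rw [← hint, ofReal_integral_eq_lintegral_ofReal hfi
    (Filter.Eventually.of_forall fun z => sq_nonneg ‖P z‖)]
  simp [hf, hPz]

/-- Duality: a bound on linear combinations of vectors gives the bound on the sum of the squared
inner products with the same constant. -/
theorem sum_norm_inner_sq_le_of_dual {H : Type*} [NormedAddCommGroup H] [InnerProductSpace ℂ H]
    {ι : Type*} (s : Finset ι) (x : ι → H) {B : ℝ} (hB : 0 ≤ B)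
    (h : ∀ c : ι → ℂ, ‖∑ k ∈ s, c k • x k‖ ^ 2 ≤ B * ∑ k ∈ s, ‖c k‖ ^ 2) (φ : H) :
    ∑ k ∈ s, ‖⟪φ, x k⟫_ℂ‖ ^ 2 ≤ B * ‖φ‖ ^ 2 := by
  set c : ι → ℂ := fun k => ⟪x k, φ⟫_ℂ with hc
  set S := ∑ k ∈ s, ‖⟪φ, x k⟫_ℂ‖ ^ 2 with hS
  have hcS : ∑ k ∈ s, ‖c k‖ ^ 2 = S :=
    Finset.sum_congr rfl fun k _ => by rw [hc, norm_inner_symm]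
  have hS0 : 0 ≤ S := Finset.sum_nonneg fun _ _ => by positivity
  have hinner : ⟪φ, ∑ k ∈ s, c k • x k⟫_ℂ = (S : ℂ) := by
    rw [inner_sum, hS, Complex.ofReal_sum]
    refine Finset.sum_congr rfl fun k _ => ?_
    simp only [hc]
    rw [inner_smul_right, ← inner_conj_symm (x k) φ, mul_comm, Complex.mul_conj,
      Complex.normSq_eq_norm_sq]
  have h1 : S ≤ ‖φ‖ * ‖∑ k ∈ s, c k • x k‖ := by
    have := norm_inner_le_norm (𝕜 := ℂ) φ (∑ k ∈ s, c k • x k)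
    rwa [hinner, Complex.norm_real, Real.norm_of_nonneg hS0] at this
  have h2 := h c
  rw [hcS] at h2
  have h3 : S * S ≤ B * ‖φ‖ ^ 2 * S := by
    calc S * S ≤ (‖φ‖ * ‖∑ k ∈ s, c k • x k‖) * (‖φ‖ * ‖∑ k ∈ s, c k • x k‖) := by gcongr
      _ = ‖φ‖ ^ 2 * ‖∑ k ∈ s, c k • x k‖ ^ 2 := by ring
      _ ≤ ‖φ‖ ^ 2 * (B * S) := by gcongr
      _ = _ := by ring
  rcases hS0.eq_or_lt with h0 | h0
  · rw [← h0]
    positivity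
  · exact le_of_mul_le_mul_right h3 h0

/-- For a uniformly Hölder continuous spectral measure, the time-averaged probability of finding
`U^k ψ` in the state `φ` decays like `K^{-α}`. -/
theorem UniformlyHolder.exists_sum_norm_inner_sq_le {U : unitary (H →L[ℂ] H)} {ψ : H} {α : ℝ}
    (hμ : UniformlyHolder α (spectralMeasure U ψ)) :
    ∃ B : ℝ, 0 < B ∧ ∀ K : ℕ, 1 ≤ K → ∀ φ : H,
      ∑ k ∈ Finset.range K, ‖⟪φ, ((U : H →L[ℂ] H) ^ k) ψ⟫_ℂ‖ ^ 2 ≤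
        K * (B * (K : ℝ) ^ (-α)) * ‖φ‖ ^ 2 := by
  obtain ⟨B, hB, h⟩ := hμ.exists_lintegral_le
  refine ⟨B, hB, fun K hK φ => sum_norm_inner_sq_le_of_dual _ _ (by positivity) (fun c => ?_) φ⟩
  have hK0 : (0 : ℝ) < K := by exact_mod_cast hK
  have h1 := h K hK c
  rw [← norm_sq_sum_smul_pow_eq_lintegral, ENNReal.ofReal_le_ofReal_iff (by positivity)] at h1
  refine h1.trans_eq ?_
  rw [sub_eq_add_neg, Real.rpow_add hK0, Real.rpow_one]
  ring

/-! ### Averages of expectations of compact operators -/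

/-- Bessel's inequality for an orthogonal family of normalized vectors, some of which may vanish
(`‖v i‖⁻¹ = 0` if `v i = 0`). -/
theorem sum_norm_inner_normalize_sq_le {H : Type*} [NormedAddCommGroup H] [InnerProductSpace ℂ H]
    {ι : Type*} {v : ι → H} (hv : ∀ i j, i ≠ j → ⟪v i, v j⟫_ℂ = 0) (s : Finset ι) (x : H) :
    ∑ i ∈ s, ‖⟪((‖v i‖⁻¹ : ℝ) : ℂ) • v i, x⟫_ℂ‖ ^ 2 ≤ ‖x‖ ^ 2 := by
  classical
  have horth : Orthonormal ℂ fun i : {i // v i ≠ 0} => ((‖v i‖⁻¹ : ℝ) : ℂ) • v i := by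
    refine ⟨fun i => ?_, fun i j hij => ?_⟩
    · rw [norm_smul, Complex.norm_real, norm_inv, norm_norm,
        inv_mul_cancel₀ (norm_ne_zero_iff.mpr i.2)]
    · simp only [inner_smul_left, inner_smul_right, hv _ _ (Subtype.coe_injective.ne hij), mul_zero]
  have h := horth.sum_inner_products_le x (s := s.subtype fun i => v i ≠ 0)
  rw [Finset.sum_subtype_eq_sum_filter (s := s) (p := fun i => v i ≠ 0)
    (f := fun i => ‖⟪((‖v i‖⁻¹ : ℝ) : ℂ) • v i, x⟫_ℂ‖ ^ 2), Finset.sum_filter] at h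
  refine le_trans (Finset.sum_le_sum fun i _ => ?_) h
  split_ifs with hi
  · rfl
  · simp [not_not.mp hi]

/-- Jensen's inequality in the form that is used for Schatten norms: weights `a i ≤ m` of total mass
at most `1` turn the `ℓ^p` norm into a bound for the weighted `ℓ¹` norm. -/
theorem ENNReal.tsum_mul_le_of_weight_le {ι : Type*} {a e : ι → ℝ≥0∞} {m : ℝ≥0∞}
    (ha : ∀ i, a i ≤ m) (hsum : ∀ s : Finset ι, ∑ i ∈ s, a i ≤ 1) {p : ℕ} (hp : 1 ≤ p) :
    ∑' i, a i * e i ≤ m ^ (1 / (p : ℝ)) * (∑' i, e i ^ p) ^ (1 / (p : ℝ)) := by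
  have hp1 : (1 : ℝ) ≤ p := by exact_mod_cast hp
  have hp0 : (0 : ℝ) ≤ 1 / p := by positivity
  rw [ENNReal.tsum_eq_iSup_sum]
  refine iSup_le fun s => (ENNReal.inner_le_weight_mul_Lp_of_nonneg s hp1 a e).trans ?_
  rw [← ENNReal.mul_rpow_of_nonneg _ _ hp0, ← one_div]
  calc (∑ i ∈ s, a i) ^ (1 - 1 / (p : ℝ)) * (∑ i ∈ s, a i * e i ^ (p : ℝ)) ^ (1 / (p : ℝ))
      ≤ 1 * (∑ i ∈ s, a i * e i ^ (p : ℝ)) ^ (1 / (p : ℝ)) := by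
        gcongr
        exact ENNReal.rpow_le_one (hsum s) (sub_nonneg.mpr (by
          rw [div_le_one (by positivity)]; exact hp1))
    _ ≤ (m * ∑' i, e i ^ p) ^ (1 / (p : ℝ)) := by
        rw [one_mul]
        refine ENNReal.rpow_le_rpow ?_ hp0
        simp only [ENNReal.rpow_natCast]
        calc ∑ i ∈ s, a i * e i ^ p ≤ ∑ i ∈ s, m * e i ^ p := by
              gcongr with i
              exact ha i
          _ = m * ∑ i ∈ s, e i ^ p := (Finset.mul_sum ..).symm
          _ ≤ _ := by
              gcongr
              exact ENNReal.sum_le_tsum s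

/-- If the time-averaged probability of finding `U^k ψ` in any normalized state is at most `m`, then
the time-averaged expectation of a compact operator is at most `m^{1/p}` times its Schatten
`p`-norm. -/
theorem ofReal_timeAverage_le {U : unitary (H →L[ℂ] H)} {ψ : H} (hψ : ‖ψ‖ = 1) {K : ℕ}
    (hK : 1 ≤ K) {m : ℝ}
    (hm : ∀ φ : H, ∑ k ∈ Finset.range K, ‖⟪φ, ((U : H →L[ℂ] H) ^ k) ψ⟫_ℂ‖ ^ 2 ≤ K * m * ‖φ‖ ^ 2)
    {A : H →L[ℂ] H} (hA : IsCompactOperator A) {p : ℕ} (hp : 1 ≤ p) :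
    ENNReal.ofReal (timeAverage U ψ A K) ≤
      ENNReal.ofReal m ^ (1 / (p : ℝ)) * schattenNorm p A := by
  have hK0 : (0 : ℝ) < K := by exact_mod_cast hK
  obtain ⟨ι, b, hb, hAb⟩ := hA.exists_singularBasis
  rw [schattenNorm_eq_tsum b hb]
  set x : ℕ → H := fun k => ((U : H →L[ℂ] H) ^ k) ψ with hx
  have hxn : ∀ k, ‖x k‖ = 1 := fun k => by
    have h := ContinuousLinearMap.norm_map_of_mem_unitary (U ^ k).2 ψ
    rwa [hψ] at h
  set u : ι → H := fun i => ((‖A (b i)‖⁻¹ : ℝ) : ℂ) • A (b i) with hu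
  have hun : ∀ i, ‖u i‖ ≤ 1 := fun i => by
    rw [hu, norm_smul, Complex.norm_real, norm_inv, norm_norm]
    exact inv_mul_le_one
  have hAu : ∀ i k, ‖⟪A (b i), x k⟫_ℂ‖ = ‖A (b i)‖ * ‖⟪u i, x k⟫_ℂ‖ := fun i k => by
    rcases eq_or_ne (A (b i)) 0 with h0 | h0
    · simp [h0]
    · rw [hu, inner_smul_left, norm_mul, RCLike.norm_conj, Complex.norm_real, norm_inv, norm_norm,
        mul_inv_cancel_left₀ (norm_ne_zero_iff.mpr h0)]
  set w : ι → ℕ → ℝ := fun i k => (‖⟪b i, x k⟫_ℂ‖ ^ 2 + ‖⟪u i, x k⟫_ℂ‖ ^ 2) / 2 with hw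
  have hw0 : ∀ i k, 0 ≤ w i k := fun i k => by positivity
  set a : ι → ℝ := fun i => 1 / (K : ℝ) * ∑ k ∈ Finset.range K, w i k with ha
  have ha0 : ∀ i, 0 ≤ a i := fun i =>
    mul_nonneg (by positivity) (Finset.sum_nonneg fun k _ => hw0 i k)
  have hm0 : 0 ≤ K * m := by
    have h := (Finset.sum_nonneg fun k _ => by positivity).trans (hm ψ)
    rwa [hψ, one_pow, mul_one] at h
  have ham : ∀ i, a i ≤ m := fun i => by
    have h1 := hm (b i)
    have h2 := (hm (u i)).trans (mul_le_of_le_one_right hm0 (pow_le_one₀ (norm_nonneg _) (hun i)))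
    rw [b.orthonormal.1 i, one_pow, mul_one] at h1
    simp only [ha, hw]
    rw [← Finset.sum_div, Finset.sum_add_distrib, one_div, inv_mul_le_iff₀ hK0]
    linarith
  have hasum : ∀ s : Finset ι, ∑ i ∈ s, a i ≤ 1 := fun s => by
    rw [ha, ← Finset.mul_sum, Finset.sum_comm, one_div, inv_mul_le_iff₀ hK0, mul_one]
    calc ∑ k ∈ Finset.range K, ∑ i ∈ s, w i k ≤ ∑ k ∈ Finset.range K, 1 := by
          refine Finset.sum_le_sum fun k _ => ?_
          have h1 := b.orthonormal.sum_inner_products_le (x k) (s := s)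
          have h2 := sum_norm_inner_normalize_sq_le hAb s (x k)
          rw [hxn, one_pow] at h1 h2
          simp only [hw]
          rw [← Finset.sum_div, Finset.sum_add_distrib]
          linarith
      _ = K := by simp
  have hterm : ∀ k, ENNReal.ofReal ‖⟪x k, A (x k)⟫_ℂ‖ ≤
      ∑' i, ENNReal.ofReal (w i k) * ENNReal.ofReal ‖A (b i)‖ := fun k => by
    refine (ofReal_norm_inner_le_tsum b A (x k)).trans (ENNReal.tsum_le_tsum fun i => ?_)
    rw [← ENNReal.ofReal_mul (hw0 i k), hAu]
    refine ENNReal.ofReal_le_ofReal ?_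
    have h1 := two_mul_le_add_sq ‖⟪b i, x k⟫_ℂ‖ ‖⟪u i, x k⟫_ℂ‖
    have h2 : ‖⟪b i, x k⟫_ℂ‖ * ‖⟪u i, x k⟫_ℂ‖ ≤ w i k := by
      simp only [hw]; linarith
    calc _ = ‖⟪b i, x k⟫_ℂ‖ * ‖⟪u i, x k⟫_ℂ‖ * ‖A (b i)‖ := by ring
      _ ≤ _ := by gcongr
  calc ENNReal.ofReal (timeAverage U ψ A K)
      = ENNReal.ofReal (1 / (K : ℝ)) *
          ∑ k ∈ Finset.range K, ENNReal.ofReal ‖⟪x k, A (x k)⟫_ℂ‖ := by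
        rw [timeAverage, ENNReal.ofReal_mul (by positivity),
          ENNReal.ofReal_sum_of_nonneg fun k _ => norm_nonneg _]
    _ ≤ ENNReal.ofReal (1 / (K : ℝ)) * ∑ k ∈ Finset.range K,
          ∑' i, ENNReal.ofReal (w i k) * ENNReal.ofReal ‖A (b i)‖ := by
        gcongr with k
        exact hterm k
    _ = ∑' i, ENNReal.ofReal (a i) * ENNReal.ofReal ‖A (b i)‖ := by
        rw [← Summable.tsum_finsetSum fun _ _ => ENNReal.summable, ← ENNReal.tsum_mul_left]
        refine tsum_congr fun i => ?_
        rw [← Finset.sum_mul, ← mul_assoc, ha, ENNReal.ofReal_mul (by positivity),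
          ENNReal.ofReal_sum_of_nonneg fun k _ => hw0 i k]
    _ ≤ _ := by
        refine ENNReal.tsum_mul_le_of_weight_le (fun i => ENNReal.ofReal_le_ofReal (ham i))
          (fun s => ?_) hp
        rw [← ENNReal.ofReal_sum_of_nonneg fun i _ => ha0 i, ← ENNReal.ofReal_one]
        exact ENNReal.ofReal_le_ofReal (hasum s)

theorem IsCompactOperator.schattenNorm_ne_zero {A : H →L[ℂ] H} (hA : IsCompactOperator A)
    (h0 : A ≠ 0) {p : ℕ} (hp : 1 ≤ p) : schattenNorm p A ≠ 0 := by
  obtain ⟨ι, b, hb, -⟩ := hA.exists_singularBasis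
  have hp0 : (0 : ℝ) < 1 / p := by
    have : (0 : ℝ) < p := by exact_mod_cast hp
    positivity
  rw [schattenNorm_eq_tsum b hb]
  intro h
  rw [ENNReal.rpow_eq_zero_iff_of_pos hp0, ENNReal.tsum_eq_zero] at h
  refine h0 (ContinuousLinearMap.ext_on ?_ ?_ (s := Set.range b))
  · rw [dense_iff_closure_eq, ← Submodule.topologicalClosure_coe, b.dense_span, Submodule.top_coe]
  · rintro _ ⟨i, rfl⟩
    simpa using (pow_eq_zero_iff (by omega)).mp (h i)

/-- The strict version of `ofReal_timeAverage_le`, obtained by increasing the constant. -/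
theorem ofReal_timeAverage_lt {U : unitary (H →L[ℂ] H)} {ψ : H} (hψ : ‖ψ‖ = 1) {K : ℕ}
    (hK : 1 ≤ K) {m M r : ℝ} (hm0 : 0 ≤ m) (hM : 0 ≤ M) (hr : 0 ≤ r) (hmr : m < M * r)
    (hm : ∀ φ : H, ∑ k ∈ Finset.range K, ‖⟪φ, ((U : H →L[ℂ] H) ^ k) ψ⟫_ℂ‖ ^ 2 ≤ K * m * ‖φ‖ ^ 2)
    {A : H →L[ℂ] H} (hA : IsCompactOperator A) (h0 : A ≠ 0) {p : ℕ} (hp : 1 ≤ p) :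
    ENNReal.ofReal (timeAverage U ψ A K) <
      ENNReal.ofReal (M ^ (1 / (p : ℝ))) * schattenNorm p A *
        ENNReal.ofReal (r ^ (1 / (p : ℝ))) := by
  have hp0 : (0 : ℝ) < 1 / p := by
    have : (0 : ℝ) < p := by exact_mod_cast hp
    positivity
  have hS := hA.schattenNorm_ne_zero h0 hp
  have hMr : ENNReal.ofReal (M ^ (1 / (p : ℝ))) * schattenNorm p A *
      ENNReal.ofReal (r ^ (1 / (p : ℝ))) =
        ENNReal.ofReal (M * r) ^ (1 / (p : ℝ)) * schattenNorm p A := by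
    rw [mul_right_comm, ← ENNReal.ofReal_mul (by positivity), ← Real.mul_rpow hM hr,
      ENNReal.ofReal_rpow_of_nonneg (by positivity) hp0.le]
  have hlt : ENNReal.ofReal m ^ (1 / (p : ℝ)) < ENNReal.ofReal (M * r) ^ (1 / (p : ℝ)) :=
    ENNReal.rpow_lt_rpow ((ENNReal.ofReal_lt_ofReal_iff_of_nonneg hm0).mpr hmr) hp0
  rw [hMr]
  rcases eq_or_ne (schattenNorm p A) ∞ with htop | htop
  · rw [htop, ENNReal.mul_top (zero_le.trans_lt hlt).ne']
    exact ENNReal.ofReal_lt_top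
  · exact (ofReal_timeAverage_le hψ hK hm hA hp).trans_lt
      (ENNReal.mul_lt_mul_left hS htop hlt)

end Dynamics

theorem mainTheorem5 {H : Type*} [NormedAddCommGroup H] [InnerProductSpace ℂ H] [CompleteSpace H]
    [TopologicalSpace.SeparableSpace H]
    (U : unitary (H →L[ℂ] H)) (ψ : H) (hψ : ‖ψ‖ = 1)
    (α : ℝ) (hα0 : 0 ≤ α) (hα1 : α ≤ 1)
    (hμ : UniformlyHolder α (spectralMeasure U ψ)) :
    ∃ C : ℝ, 0 < C ∧ ∀ A : H →L[ℂ] H, IsCompactOperator A → ∀ p : ℕ, 1 ≤ p →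
      (α < 1 → ∀ K : ℕ, 1 ≤ K →
        ENNReal.ofReal (timeAverage U ψ A K) ≤
          ENNReal.ofReal (C ^ (1 / (p : ℝ))) * schattenNorm p A *
            ENNReal.ofReal ((K : ℝ) ^ (-α / (p : ℝ))) ∧
        (A ≠ 0 → ENNReal.ofReal (timeAverage U ψ A K) <
          ENNReal.ofReal (C ^ (1 / (p : ℝ))) * schattenNorm p A *
            ENNReal.ofReal ((K : ℝ) ^ (-α / (p : ℝ))))) ∧
      (α = 1 → ∀ K : ℕ, 2 ≤ K →
        ENNReal.ofReal (timeAverage U ψ A K) ≤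
          ENNReal.ofReal (C ^ (1 / (p : ℝ))) * schattenNorm p A *
            ENNReal.ofReal ((Real.log K / (K : ℝ)) ^ (1 / (p : ℝ))) ∧
        (A ≠ 0 → ENNReal.ofReal (timeAverage U ψ A K) <
          ENNReal.ofReal (C ^ (1 / (p : ℝ))) * schattenNorm p A *
            ENNReal.ofReal ((Real.log K / (K : ℝ)) ^ (1 / (p : ℝ))))) := by
  obtain ⟨B, hB, hbound⟩ := hμ.exists_sum_norm_inner_sq_le
  refine ⟨2 * B, by positivity, fun A hA p hp => ?_⟩
  have hle : ∀ (K : ℕ) (R : ℝ≥0∞), (A ≠ 0 → ENNReal.ofReal (timeAverage U ψ A K) < R) →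
      ENNReal.ofReal (timeAverage U ψ A K) ≤ R := fun K R h => by
    rcases eq_or_ne A 0 with rfl | h0
    · simp [timeAverage]
    · exact (h h0).le
  refine ⟨fun _ K hK => ?_, fun hα K hK => ?_⟩
  · have hK0 : (0 : ℝ) < K := by exact_mod_cast hK
    have hr : 0 < (K : ℝ) ^ (-α) := Real.rpow_pos_of_pos hK0 _
    have hexp : (K : ℝ) ^ (-α / (p : ℝ)) = ((K : ℝ) ^ (-α)) ^ (1 / (p : ℝ)) := by
      rw [← Real.rpow_mul hK0.le, mul_one_div]
    have hstrict := fun h0 : A ≠ 0 => ofReal_timeAverage_lt hψ hK (m := B * (K : ℝ) ^ (-α))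
      (M := 2 * B) (r := (K : ℝ) ^ (-α)) (by positivity) (by positivity) hr.le
      (by nlinarith [mul_pos hB hr]) (hbound K hK) hA h0 hp
    rw [hexp]
    exact ⟨hle K _ hstrict, hstrict⟩
  · have hK1 : 1 ≤ K := by omega
    have hK2 : (2 : ℝ) ≤ K := by exact_mod_cast hK
    have hK0 : (0 : ℝ) < K := by linarith
    -- `2 log K ≥ 2 log 2 > 1`, so the factor `2` absorbs the missing logarithm
    have hlog : 1 < 2 * Real.log K := by
      have := Real.log_le_log two_pos hK2
      linarith [Real.log_two_gt_d9]
    have hpow : (K : ℝ) ^ (-α) = (K : ℝ)⁻¹ := by rw [hα, Real.rpow_neg_one]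
    have hlt : B * (K : ℝ) ^ (-α) < 2 * B * (Real.log K / K) := by
      have h : 2 * B * (Real.log K / K) = B * (K : ℝ)⁻¹ * (2 * Real.log K) := by
        field_simp
      rw [hpow, h]
      exact lt_mul_of_one_lt_right (by positivity) hlog
    have hstrict := fun h0 : A ≠ 0 => ofReal_timeAverage_lt hψ hK1 (by positivity)
      (by positivity) (div_nonneg (by linarith) hK0.le) hlt (hbound K hK1) hA h0 hp
    exact ⟨hle K _ hstrict, hstrict⟩
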